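/- Let $d\ge 2$, $\alpha\in(1,2)$, $\delta\in(0,1-1/\alpha]$, $a>1$ and $R>0$. Let $(X_t)_{t\ge 0}$ be the $\mathbb{R}^d$-valued symmetric $\alpha$-stable process started at $0$, i.e. the càdlàg Lévy process with $\mathbb{E}[e^{i\langle \xi,X_t\rangle}]=e^{-t|\xi|^\alpha}$ for $\xi\in\mathbb{R}^d$, $t\ge 0$, and let $\tau_B(0):=\inf\{t\ge 0 : X_t\notin B(0,R)\}$ be its exit time from the open ball $B(0,R)$ of radius $R$ centred at $0$. Let $\kappa_1,\kappa_2>0$ be such that $$\rho(t):=\kappa_1 t^{\delta-1}e^{-t}\mathbf{1}_{[0,1]}(t)+\frac{\kappa_2}{t^{a}}\mathbf{1}_{(1,\infty)}(t),\qquad t>0,$$ is a probability density function on $(0,\infty)$, and let $\overline F(s):=\int_s^\infty\rho(t)\,dt$, with $\overline F(\infty)=0$ and the convention $1/0=\infty$. Then $\rho$ satisfies the following two conditions (Assumption (C)): $$\text{(i)}\quad \sup_{t\in(0,1]}\frac{1}{\rho(t)\,t^{1/\alpha}}<\infty,\qquad\qquad \text{(ii)}\quad \mathbb{E}\!\left[\frac{1}{\overline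 F(\tau_B(0))}\right]=\mathbb{E}\!\left[\left(\int_{\tau_B(0)}^\infty\rho(t)\,dt\right)^{-1}\right]<\infty .$$ -/

import Mathlib

open MeasureTheory ProbabilityTheory Filter Topology
open scoped NNReal ENNReal

noncomputable section

/-- A path `ℝ₊ → E` is càdlàg: right-continuous, with left limits. -/
def IsCadlagPath {E : Type*} [TopologicalSpace E] (f : ℝ≥0 → E) : Prop :=
  ∀ t : ℝ≥0, ContinuousWithinAt f (Set.Ici t) t ∧ ∃ l : E, Tendsto f (𝓝[<] t) (𝓝 l)

/-- `X` is an `ℝᵈ`-valued (rotationally) symmetric `α`-stable process started at `0`, that is, the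
Lévy process with generator `-(-Δ)^{α/2}`: it starts at `0`, has independent increments,
its increments over an interval of length `t` have characteristic function `ξ ↦ exp (-t |ξ|^α)`
(so they are stationary), and it has càdlàg paths almost surely. -/
structure IsSymmetricStableProcess {Ω : Type*} [MeasurableSpace Ω] {d : ℕ} (α : ℝ)
    (X : ℝ≥0 → Ω → EuclideanSpace ℝ (Fin d)) (P : Measure Ω) : Prop where
  measurable : ∀ t, Measurable (X t)
  start : ∀ᵐ ω ∂P, X 0 ω = 0
  indep_increments : HasIndepIncrements X P
  charFun_increment : ∀ (s t : ℝ≥0) (ξ : EuclideanSpace ℝ (Fin d)),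
    charFun (P.map (fun ω => X (s + t) ω - X s ω)) ξ
      = Complex.exp (((-((t : ℝ) * ‖ξ‖ ^ α) : ℝ)) : ℂ)
  cadlag : ∀ᵐ ω ∂P, IsCadlagPath (fun t => X t ω)

/-- The exit time `τ_B(x) = inf {t ≥ 0 : x + X_t ∉ B(0,R)}` from the open ball, in `[0,∞]`
(equal to `∞` if the path never leaves the ball). -/
def exitTime {Ω : Type*} {d : ℕ} (R : ℝ) (X : ℝ≥0 → Ω → EuclideanSpace ℝ (Fin d))
    (x : EuclideanSpace ℝ (Fin d)) (ω : Ω) : ℝ≥0∞ :=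
  ⨅ (t : ℝ≥0) (_ : x + X t ω ∉ Metric.ball (0 : EuclideanSpace ℝ (Fin d)) R), (t : ℝ≥0∞)

/-- The tail `F̄(s) = ∫_s^∞ ρ(t) dt` of a density `ρ` on `(0,∞)`, for `s ∈ [0,∞]`; `F̄(∞) = 0`. -/
def tailFun (ρ : ℝ → ℝ) (s : ℝ≥0∞) : ℝ≥0∞ :=
  ∫⁻ t in {t : ℝ | 0 < t ∧ s < ENNReal.ofReal t}, ENNReal.ofReal (ρ t)

/-- The density `ρ` satisfies Assumption (C), for the process `X` and the ball `B(0,R)`.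
Both quantities are computed in `[0,∞]`, with `1/0 = ∞`. -/
structure AssumptionC {Ω : Type*} [MeasurableSpace Ω] {d : ℕ} (α R : ℝ)
    (X : ℝ≥0 → Ω → EuclideanSpace ℝ (Fin d)) (P : Measure Ω) (ρ : ℝ → ℝ) : Prop where
  /-- `sup_{t ∈ (0,1]} 1 / (ρ(t) t^{1/α}) < ∞` -/
  sup_lt_top : (⨆ t ∈ Set.Ioc (0 : ℝ) 1, (ENNReal.ofReal (ρ t * t ^ (1 / α)))⁻¹) < ∞
  /-- `1 / F̄(τ_B(0))` is a random variable (up to a null set), so that its expectation makes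
  sense -/
  aemeasurable : AEMeasurable (fun ω => (tailFun ρ (exitTime R X 0 ω))⁻¹) P
  /-- `E [1 / F̄(τ_B(0))] < ∞` -/
  expectation_lt_top : (∫⁻ ω, (tailFun ρ (exitTime R X 0 ω))⁻¹ ∂P) < ∞

/-- `ρ(t) = κ₁ t^{δ-1} e^{-t} 1_{[0,1]}(t) + κ₂ t^{-a} 1_{(1,∞)}(t)`. -/
def rhoDensity (κ₁ κ₂ δ a : ℝ) (t : ℝ) : ℝ :=
  Set.indicator (Set.Icc 0 1) (fun s : ℝ => κ₁ * s ^ (δ - 1) * Real.exp (-s)) t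
    + Set.indicator (Set.Ioi 1) (fun s : ℝ => κ₂ / s ^ a) t

end

/-! Condition (i) is an exponent count: `δ ≤ 1 - 1/α` makes `t ^ (δ - 1 + 1/α)` at least `1` on
`(0,1]`.

For (ii), `1/F̄` grows only polynomially because `ρ` has a power tail, while the exit time has a
geometric tail. Staying in the ball at the times `0, …, n` forces `n` independent unit increments to
have norm below `2R`, so survival has probability at most `q ^ n` (`measure_forall_norm_lt_le`).
Here `q < 1` because a bounded increment would have a characteristic function too flat at the origin
when `α < 2` (`measure_norm_increment_lt_lt_one`).

Measurability of the exit time needs care, as a càdlàg path can have supremum exactly `R` without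
leaving the ball. By self-similarity the supremum up to time `t` has an atom at `R` for only
countably many `t > 0`. Along a countable dense set of other times, exit is detected almost surely
by that supremum (`aemeasurable_exitTime`). -/

namespace IsSymmetricStableProcess

/-! ### Self-similarity of increments and of discrete skeletons. -/

variable {Ω : Type*} [MeasurableSpace Ω] {P : Measure Ω} [IsProbabilityMeasure P] {d : ℕ} {α : ℝ}
  {X : ℝ≥0 → Ω → EuclideanSpace ℝ (Fin d)}

/-- Stationarity and self-similarity of the increments. -/
lemma identDistrib_increment_smul (hX : IsSymmetricStableProcess α X P) (hα : 0 < α)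
    (c h s s' : ℝ≥0) :
    IdentDistrib (fun ω => X (s + c * h) ω - X s ω)
      (fun ω => ((c : ℝ) ^ (1 / α)) • (X (s' + h) ω - X s' ω)) P P := by
  have hm : ∀ u v, Measurable (fun ω => X u ω - X v ω) := fun u v =>
    (hX.measurable u).sub (hX.measurable v)
  refine ⟨(hm _ _).aemeasurable, ((measurable_const_smul _).comp (hm _ _)).aemeasurable, ?_⟩
  have hc : (0 : ℝ) ≤ c := c.2
  have i1 := Measure.isProbabilityMeasure_map (μ := P) (hm (s + c * h) s).aemeasurable
  have i2 := Measure.isProbabilityMeasure_map (μ := P)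
    ((measurable_const_smul ((c : ℝ) ^ (1 / α))).comp (hm (s' + h) s')).aemeasurable
  refine Measure.ext_of_charFun ?_
  ext ξ
  rw [charFun_map_smul_comp (hm _ _).aemeasurable, hX.charFun_increment, hX.charFun_increment,
    norm_smul, Real.norm_of_nonneg (Real.rpow_nonneg hc _),
    Real.mul_rpow (Real.rpow_nonneg hc _) (norm_nonneg _), ← Real.rpow_mul hc,
    one_div_mul_cancel hα.ne', Real.rpow_one]
  push_cast
  ring_nf

/-- Self-similarity of the process along an arithmetic progression of times. -/
lemma identDistrib_skeleton_smul (hX : IsSymmetricStableProcess α X P) (hα : 0 < α) (c h : ℝ≥0) :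
    IdentDistrib (fun ω (k : ℕ) => X (k * (c * h)) ω)
      (fun ω (k : ℕ) => ((c : ℝ) ^ (1 / α)) • X (k * h) ω) P P := by
  have hmono : ∀ r : ℝ≥0, Monotone (fun k : ℕ => (k : ℝ≥0) * r) := fun r i j hij => by
    dsimp only; gcongr
  have hpi := IdentDistrib.pi (μ := P) (ν := P)
    (X := fun (k : ℕ) ω => X ((k + 1 : ℕ) * (c * h)) ω - X (k * (c * h)) ω)
    (Y := fun (k : ℕ) ω => ((c : ℝ) ^ (1 / α)) • (X ((k + 1 : ℕ) * h) ω - X (k * h) ω))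
    (fun k => by
      have := hX.identDistrib_increment_smul hα c h (k * (c * h)) (k * h)
      have e1 : ((k + 1 : ℕ) : ℝ≥0) * (c * h) = k * (c * h) + c * h := by push_cast; ring
      have e2 : ((k + 1 : ℕ) : ℝ≥0) * h = k * h + h := by push_cast; ring
      rw [e1, e2]; exact this)
    (hX.indep_increments.nat (hmono (c * h)))
    ((hX.indep_increments.nat (hmono h)).comp (fun _ x => ((c : ℝ) ^ (1 / α)) • x)
      (fun _ => measurable_const_smul _))
  -- Partial sums of the increments telescope back to the skeleton, since `X 0 = 0` almost surely.
  have hsum : Measurable (fun (y : ℕ → EuclideanSpace ℝ (Fin d)) (k : ℕ) =>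
      ∑ j ∈ Finset.range k, y j) :=
    measurable_pi_lambda _ fun k => Finset.measurable_sum _ fun j _ => measurable_pi_apply j
  have hcomp := hpi.comp hsum
  have e1 : ((fun (y : ℕ → EuclideanSpace ℝ (Fin d)) (k : ℕ) => ∑ j ∈ Finset.range k, y j) ∘
      fun ω (k : ℕ) => X ((k + 1 : ℕ) * (c * h)) ω - X (k * (c * h)) ω)
        =ᵐ[P] fun ω (k : ℕ) => X (k * (c * h)) ω := by
    filter_upwards [hX.start] with ω hω
    funext k
    simp only [Function.comp]
    rw [Finset.sum_range_sub (fun k : ℕ => X (k * (c * h)) ω)]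
    simp [hω]
  have e2 : ((fun (y : ℕ → EuclideanSpace ℝ (Fin d)) (k : ℕ) => ∑ j ∈ Finset.range k, y j) ∘
      fun ω (k : ℕ) => ((c : ℝ) ^ (1 / α)) • (X ((k + 1 : ℕ) * h) ω - X (k * h) ω))
        =ᵐ[P] fun ω (k : ℕ) => ((c : ℝ) ^ (1 / α)) • X (k * h) ω := by
    filter_upwards [hX.start] with ω hω
    funext k
    simp only [Function.comp]
    rw [← Finset.smul_sum, Finset.sum_range_sub (fun k : ℕ => X (k * h) ω)]
    simp [hω]
  have a1 : Measurable (fun ω (k : ℕ) => X (k * (c * h)) ω) :=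
    measurable_pi_lambda _ fun k => hX.measurable _
  have a2 : Measurable (fun ω (k : ℕ) => ((c : ℝ) ^ (1 / α)) • X (k * h) ω) :=
    measurable_pi_lambda _ fun k => (measurable_const_smul _).comp (hX.measurable _)
  exact ((IdentDistrib.of_ae_eq a1.aemeasurable e1.symm).trans hcomp).trans
    (IdentDistrib.of_ae_eq a2.aemeasurable e2.symm).symm

end IsSymmetricStableProcess

/-- The maximum of `‖f‖` over the dyadic grid of mesh `t / 2 ^ n` in `[0, t]`. -/
noncomputable def gridMax {E : Type*} [NormedAddCommGroup E] (f : ℝ≥0 → E) (t : ℝ≥0) (n : ℕ) :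
    ℝ≥0∞ :=
  ⨆ (k : ℕ) (_ : k ≤ 2 ^ n), ‖f (k * (t * (1 / 2 ^ n)))‖ₑ

/-- The supremum of `‖f‖` over the dyadic multiples of `t` in `[0, t]`. -/
noncomputable def dyadicSup {E : Type*} [NormedAddCommGroup E] (f : ℝ≥0 → E) (t : ℝ≥0) : ℝ≥0∞ :=
  ⨆ n, gridMax f t n

/-! ### Dyadic suprema of paths. -/

section dyadicSup

variable {E : Type*} [NormedAddCommGroup E]

lemma gridMax_mono (f : ℝ≥0 → E) (t : ℝ≥0) : Monotone (gridMax f t) := by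
  refine monotone_nat_of_le_succ fun n => iSup₂_le fun k hk => ?_
  refine le_trans (le_of_eq ?_) (le_iSup₂ (f := fun (k : ℕ) (_ : k ≤ 2 ^ (n + 1)) =>
    ‖f (k * (t * (1 / 2 ^ (n + 1))))‖ₑ) (2 * k) (by rw [pow_succ]; omega))
  congr 2
  push_cast
  field_simp
  ring

lemma measurable_gridMax [MeasurableSpace E] [OpensMeasurableSpace E] {Ω : Type*}
    [MeasurableSpace Ω] {X : ℝ≥0 → Ω → E} (hX : ∀ t, Measurable (X t)) (t : ℝ≥0) (n : ℕ) :
    Measurable (fun ω => gridMax (X · ω) t n) :=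
  Measurable.iSup fun _ => Measurable.iSup fun _ => (hX _).enorm

lemma measurable_dyadicSup [MeasurableSpace E] [OpensMeasurableSpace E] {Ω : Type*}
    [MeasurableSpace Ω] {X : ℝ≥0 → Ω → E} (hX : ∀ t, Measurable (X t)) (t : ℝ≥0) :
    Measurable (fun ω => dyadicSup (X · ω) t) :=
  Measurable.iSup fun n => measurable_gridMax hX t n

lemma exists_of_lt_dyadicSup {f : ℝ≥0 → E} {t : ℝ≥0} {r : ℝ≥0∞} (h : r < dyadicSup f t) :
    ∃ u ≤ t, r < ‖f u‖ₑ := by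
  simp only [dyadicSup, gridMax, lt_iSup_iff] at h
  obtain ⟨n, k, hk, hlt⟩ := h
  refine ⟨_, ?_, hlt⟩
  have hk' : (k : ℝ≥0) ≤ 2 ^ n := by exact_mod_cast hk
  calc (k : ℝ≥0) * (t * (1 / 2 ^ n)) ≤ 2 ^ n * (t * (1 / 2 ^ n)) := by gcongr
    _ = t := by field_simp

/-- Rounding `u` up to the grid gives dyadic points converging to `u` from the right, so
right-continuity suffices. -/
lemma IsCadlagPath.enorm_le_dyadicSup {f : ℝ≥0 → E} (hf : IsCadlagPath f) {u t : ℝ≥0}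
    (hut : u < t) : ‖f u‖ₑ ≤ dyadicSup f t := by
  have ht : 0 < t := bot_le.trans_lt hut
  have key : ∀ n : ℕ, ‖f ((⌈u / t * 2 ^ n⌉₊ : ℝ≥0) * (t * (1 / 2 ^ n)))‖ₑ ≤ dyadicSup f t := by
    intro n
    refine le_trans ?_ (le_iSup (gridMax f t) n)
    refine le_iSup₂ (f := fun (k : ℕ) (_ : k ≤ 2 ^ n) => ‖f (k * (t * (1 / 2 ^ n)))‖ₑ) _ ?_
    refine Nat.ceil_le.2 ?_
    push_cast
    have : u / t ≤ 1 := (div_le_one ht).2 hut.le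
    calc u / t * 2 ^ n ≤ 1 * 2 ^ n := by gcongr
      _ = _ := one_mul _
  have hge : ∀ n : ℕ, u ≤ (⌈u / t * 2 ^ n⌉₊ : ℝ≥0) * (t * (1 / 2 ^ n)) := by
    intro n
    calc u = (u / t * 2 ^ n) * (t * (1 / 2 ^ n)) := by field_simp
      _ ≤ _ := by gcongr; exact Nat.le_ceil _
  have hle : ∀ n : ℕ, (⌈u / t * 2 ^ n⌉₊ : ℝ≥0) * (t * (1 / 2 ^ n)) ≤ u + t * (1 / 2) ^ n := by
    intro n
    calc _ ≤ (u / t * 2 ^ n + 1) * (t * (1 / 2 ^ n)) := by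
          gcongr; exact (Nat.ceil_lt_add_one bot_le).le
      _ = u + t * (1 / 2) ^ n := by rw [one_div_pow]; field_simp
  have hlim : Tendsto (fun n : ℕ => u + t * (1 / 2 : ℝ≥0) ^ n) atTop (𝓝 u) := by
    have h0 : Tendsto (fun n : ℕ => (1 / 2 : ℝ≥0) ^ n) atTop (𝓝 0) :=
      NNReal.tendsto_pow_atTop_nhds_zero_of_lt_one (by
        rw [← NNReal.coe_lt_coe]; norm_num)
    simpa using (h0.const_mul t).const_add u
  have hconv : Tendsto (fun n : ℕ => (⌈u / t * 2 ^ n⌉₊ : ℝ≥0) * (t * (1 / 2 ^ n))) atTop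
      (𝓝[Set.Ici u] u) :=
    tendsto_nhdsWithin_iff.2 ⟨tendsto_of_tendsto_of_tendsto_of_le_of_le tendsto_const_nhds hlim
      hge hle, Eventually.of_forall hge⟩
  exact le_of_tendsto ((continuous_enorm.tendsto _).comp ((hf u).1.tendsto.comp hconv))
    (Eventually.of_forall key)

end dyadicSup

/-! ### Law of the running supremum and measurability of the exit time. -/

namespace IsSymmetricStableProcess

variable {Ω : Type*} [MeasurableSpace Ω] {P : Measure Ω} [IsProbabilityMeasure P] {d : ℕ} {α : ℝ}
  {X : ℝ≥0 → Ω → EuclideanSpace ℝ (Fin d)}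

lemma identDistrib_gridMax (hX : IsSymmetricStableProcess α X P) (hα : 0 < α) (t : ℝ≥0) (n : ℕ) :
    IdentDistrib (fun ω => gridMax (X · ω) t n)
      (fun ω => ‖(t : ℝ) ^ (1 / α)‖ₑ * gridMax (X · ω) 1 n) P P := by
  have hu : Measurable (fun y : ℕ → EuclideanSpace ℝ (Fin d) =>
      ⨆ (k : ℕ) (_ : k ≤ 2 ^ n), ‖y k‖ₑ) :=
    Measurable.iSup fun k => Measurable.iSup fun _ => (measurable_pi_apply k).enorm
  have h := (hX.identDistrib_skeleton_smul hα t (1 / 2 ^ n)).comp hu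
  simpa only [gridMax, Function.comp_def, enorm_smul, ENNReal.mul_iSup, one_mul] using h

/-- Self-similarity of the running supremum. -/
lemma identDistrib_dyadicSup (hX : IsSymmetricStableProcess α X P) (hα : 0 < α) (t : ℝ≥0) :
    IdentDistrib (fun ω => dyadicSup (X · ω) t)
      (fun ω => ‖(t : ℝ) ^ (1 / α)‖ₑ * dyadicSup (X · ω) 1) P P := by
  have m1 := measurable_dyadicSup hX.measurable t
  have m2 := (measurable_dyadicSup hX.measurable 1).const_mul ‖(t : ℝ) ^ (1 / α)‖ₑ
  refine ⟨m1.aemeasurable, m2.aemeasurable, ?_⟩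
  have := Measure.isProbabilityMeasure_map (μ := P) m1.aemeasurable
  refine Measure.ext_of_Iic _ _ fun r => ?_
  rw [Measure.map_apply m1 measurableSet_Iic, Measure.map_apply m2 measurableSet_Iic]
  -- The events `g n ≤ r` decrease to the event that the supremum is at most `r`, so distribution
  -- functions pass to the limit.
  have aux : ∀ g : ℕ → Ω → ℝ≥0∞, (∀ n, Measurable (g n)) → (∀ ω, Monotone (g · ω)) →
      Tendsto (fun n => P {ω | g n ω ≤ r}) atTop (𝓝 (P {ω | ⨆ n, g n ω ≤ r})) := by
    intro g hg hmono
    have e : {ω | ⨆ n, g n ω ≤ r} = ⋂ n, {ω | g n ω ≤ r} := by ext ω; simp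
    rw [e]
    exact tendsto_measure_iInter_atTop
      (fun n => (measurableSet_le (hg n) measurable_const).nullMeasurableSet)
      (fun i j hij ω hω => (hmono ω hij).trans hω) ⟨0, measure_ne_top _ _⟩
  have t1 := aux (fun n ω => gridMax (X · ω) t n) (measurable_gridMax hX.measurable t)
    (fun ω => gridMax_mono _ _)
  have t2 := aux (fun n ω => ‖(t : ℝ) ^ (1 / α)‖ₑ * gridMax (X · ω) 1 n)
    (fun n => (measurable_gridMax hX.measurable 1 n).const_mul _)
    (fun ω i j hij => by dsimp only; gcongr; exact gridMax_mono _ _ hij)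
  have e : ∀ n, P {ω | gridMax (X · ω) t n ≤ r}
      = P {ω | ‖(t : ℝ) ^ (1 / α)‖ₑ * gridMax (X · ω) 1 n ≤ r} := fun n =>
    (hX.identDistrib_gridMax hα t n).measure_mem_eq measurableSet_Iic
  simp only [e] at t1
  have := tendsto_nhds_unique t1 t2
  simpa only [dyadicSup, ENNReal.mul_iSup, Set.preimage, Set.mem_Iic] using this

/-- For all but countably many times `t`, the running supremum at time `t` does not charge `r`. -/
lemma dense_dyadicSup_ne (hX : IsSymmetricStableProcess α X P) (hα : 0 < α) {r : ℝ≥0∞}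
    (hr0 : r ≠ 0) (hr : r ≠ ∞) : Dense {t : ℝ≥0 | ∀ᵐ ω ∂P, dyadicSup (X · ω) t ≠ r} := by
  -- An atom at `r` at time `t > 0` is an atom of the supremum at time `1` at level `r / t ^ (1/α)`.
  -- These levels are distinct for distinct `t`, and a law has countably many atoms.
  have hc := Measure.countable_meas_level_set_pos (μ := P) (measurable_dyadicSup hX.measurable 1)
  have hbad : {t : ℝ≥0 | 0 < t ∧ ¬ ∀ᵐ ω ∂P, dyadicSup (X · ω) t ≠ r}.Countable := by
    have hinj : Set.InjOn (fun t : ℝ≥0 => r / ‖(t : ℝ) ^ (1 / α)‖ₑ) (Set.Ioi 0) := by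
      intro s hs t ht hst
      have hs' : (0 : ℝ) < s := hs
      have ht' : (0 : ℝ) < t := ht
      have h1 : ‖(s : ℝ) ^ (1 / α)‖ₑ = ‖(t : ℝ) ^ (1 / α)‖ₑ := by
        simp only [div_eq_mul_inv] at hst
        exact inv_injective ((ENNReal.mul_right_inj hr0 hr).1 hst)
      rw [Real.enorm_of_nonneg (by positivity), Real.enorm_of_nonneg (by positivity),
        ENNReal.ofReal_eq_ofReal_iff (by positivity) (by positivity)] at h1
      exact NNReal.coe_injective
        ((Real.rpow_left_inj hs'.le ht'.le (one_div_pos.2 hα).ne').1 h1)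
    refine Set.MapsTo.countable_of_injOn (f := fun t : ℝ≥0 => r / ‖(t : ℝ) ^ (1 / α)‖ₑ)
      ?_ (hinj.mono fun t ht => ht.1) hc
    rintro t ⟨ht, hbad⟩
    have ht' : (0 : ℝ) < t := ht
    have hne : (t : ℝ) ^ (1 / α) ≠ 0 := by positivity
    rw [ae_iff] at hbad
    simp only [ne_eq, not_not] at hbad
    have h := (hX.identDistrib_dyadicSup hα t).measure_mem_eq (measurableSet_singleton r)
    simp only [Set.preimage, Set.mem_singleton_iff] at h
    rw [h] at hbad
    have e : {ω | ‖(t : ℝ) ^ (1 / α)‖ₑ * dyadicSup (X · ω) 1 = r}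
        = {ω | dyadicSup (X · ω) 1 = r / ‖(t : ℝ) ^ (1 / α)‖ₑ} := by
      ext ω
      simp only [Set.mem_ofPred_eq]
      rw [ENNReal.eq_div_iff (by simpa using hne) (by simp)]
    rw [e] at hbad
    exact pos_iff_ne_zero.2 hbad
  refine dense_of_exists_between fun a b hab => ?_
  obtain ⟨c, hc, hac, hcb⟩ := ((hbad.image NNReal.toReal).dense_compl ℝ).exists_between
    (NNReal.coe_lt_coe.2 hab)
  have hc0 : (0 : ℝ) < c := a.2.trans_lt hac
  lift c to ℝ≥0 using hc0.le
  refine ⟨c, ?_, hac, hcb⟩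
  by_contra hcon
  exact hc ⟨c, ⟨hc0, hcon⟩, rfl⟩

/-- The exit time from a ball is a random variable, up to a null set. -/
lemma aemeasurable_exitTime (hX : IsSymmetricStableProcess α X P) (hα : 0 < α) {R : ℝ}
    (hR : 0 < R) : AEMeasurable (exitTime R X 0) P := by
  obtain ⟨D, hDs, hDc, hDd⟩ := (hX.dense_dyadicSup_ne hα (r := ENNReal.ofReal R)
    (by simpa using hR) (by simp)).exists_countable_dense_subset
  have hball : ∀ x : EuclideanSpace ℝ (Fin d),
      0 + x ∉ Metric.ball (0 : EuclideanSpace ℝ (Fin d)) R ↔ ENNReal.ofReal R ≤ ‖x‖ₑ := by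
    intro x
    rw [zero_add, mem_ball_zero_iff, not_lt, ← ofReal_norm, ENNReal.ofReal_le_ofReal_iff
      (norm_nonneg _)]
  -- For `t ∈ D`, a supremum at least `R` is almost surely strictly larger, hence witnessed by a
  -- genuine exit by time `t`. Conversely, an exit at `u` is seen by every `t ∈ D` with `t > u`.
  refine ⟨fun ω => ⨅ t ∈ D, if ENNReal.ofReal R ≤ dyadicSup (X · ω) t then (t : ℝ≥0∞) else ∞,
    ?_, ?_⟩
  · exact Measurable.biInf D hDc fun t _ => Measurable.ite
      (measurableSet_le measurable_const (measurable_dyadicSup hX.measurable t))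
      measurable_const measurable_const
  filter_upwards [hX.cadlag, (ae_ball_iff hDc).2 fun t ht => hDs ht] with ω hcad hne
  apply le_antisymm
  · refine le_iInf₂ fun t ht => ?_
    split_ifs with h
    · obtain ⟨u, hut, hu⟩ := exists_of_lt_dyadicSup (lt_of_le_of_ne h (hne t ht).symm)
      exact (iInf₂_le u ((hball _).2 hu.le)).trans (by exact_mod_cast hut)
    · exact le_top
  · refine le_iInf₂ fun u hu => ?_
    refine ENNReal.le_of_forall_pos_le_add fun ε hε _ => ?_
    obtain ⟨t, htD, hut, hte⟩ := hDd.exists_between (lt_add_of_pos_right u hε)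
    refine (iInf₂_le t htD).trans ?_
    rw [if_pos (((hball _).1 hu).trans (hcad.enorm_le_dyadicSup hut))]
    exact_mod_cast hte.le

end IsSymmetricStableProcess

/-! ### Geometric decay of the survival probability. -/

namespace IsSymmetricStableProcess

variable {Ω : Type*} [MeasurableSpace Ω] {P : Measure Ω} [IsProbabilityMeasure P] {d : ℕ} {α : ℝ}
  {X : ℝ≥0 → Ω → EuclideanSpace ℝ (Fin d)}

/-- The increments are not bounded: otherwise their characteristic function `exp (-‖ξ‖ ^ α)`
would be `1 - O(‖ξ‖ ^ 2)` at the origin. -/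
lemma measure_norm_increment_lt_lt_one (hX : IsSymmetricStableProcess α X P) (hd : 0 < d)
    (hα : α ∈ Set.Ioo (0 : ℝ) 2) (r : ℝ) :
    P {ω | ‖X (0 + 1) ω - X 0 ω‖ < r} < 1 := by
  have hm : Measurable (fun ω => X (0 + 1) ω - X 0 ω) :=
    (hX.measurable _).sub (hX.measurable _)
  refine lt_of_le_of_ne prob_le_one fun h1 => ?_
  have hae : ∀ᵐ ω ∂P, ‖X (0 + 1) ω - X 0 ω‖ < r :=
    (prob_compl_eq_zero_iff (measurableSet_lt hm.norm measurable_const)).2 h1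
  -- Real part of the characteristic function, with `cos x ≥ 1 - x ^ 2 / 2` and Cauchy–Schwarz.
  have hbound : ∀ ξ : EuclideanSpace ℝ (Fin d),
      1 - r ^ 2 * ‖ξ‖ ^ 2 / 2 ≤ Real.exp (-‖ξ‖ ^ α) := by
    intro ξ
    have hint : Integrable (fun ω => Complex.exp
        ((inner ℝ (X (0 + 1) ω - X 0 ω) ξ : ℝ) * Complex.I)) P := by
      refine Integrable.of_bound (C := 1) ?_ (Eventually.of_forall fun ω => ?_)
      · exact Measurable.aestronglyMeasurable (by fun_prop)
      · rw [Complex.norm_exp_ofReal_mul_I]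
    have h2 := hX.charFun_increment 0 1 ξ
    rw [charFun_apply, integral_map hm.aemeasurable (by fun_prop)] at h2
    have h3 := congrArg Complex.re h2
    rw [← Complex.ofReal_exp, Complex.ofReal_re] at h3
    have h4 := integral_re hint
    simp only [RCLike.re_eq_complex_re] at h4
    rw [← h4] at h3
    simp only [Complex.exp_ofReal_mul_I_re, NNReal.coe_one, one_mul] at h3
    rw [← h3]
    have hcos : Integrable (fun ω => Real.cos (inner ℝ (X (0 + 1) ω - X 0 ω) ξ)) P := by
      have := hint.re
      simpa only [RCLike.re_eq_complex_re, Complex.exp_ofReal_mul_I_re] using this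
    calc 1 - r ^ 2 * ‖ξ‖ ^ 2 / 2 = ∫ _, (1 - r ^ 2 * ‖ξ‖ ^ 2 / 2) ∂P := by simp
      _ ≤ _ := by
        refine integral_mono_ae (integrable_const _) hcos ?_
        filter_upwards [hae] with ω hω
        refine le_trans ?_ Real.one_sub_sq_div_two_le_cos
        have h5 : |inner ℝ (X (0 + 1) ω - X 0 ω) ξ| ≤ r * ‖ξ‖ :=
          (abs_real_inner_le_norm _ _).trans (by gcongr)
        have h6 := sq_le_sq' (abs_le.1 h5).1 (abs_le.1 h5).2
        rw [mul_pow] at h6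
        exact sub_le_sub_left (div_le_div_of_nonneg_right h6 zero_le_two) 1
  -- Since `α < 2`, some `x ∈ (0,1)` has `r ^ 2 * x ^ 2 < x ^ α`. With `y = x ^ α`, the bound yields
  -- `1 - y / 2 < exp (-y) ≤ 1 / (1 + y)`, which is false for `0 < y < 1`.
  have htend := tendsto_rpow_neg_nhdsGT_zero (y := α - 2) (by linarith [hα.2])
  obtain ⟨x, hx, hx0, hx1⟩ := ((htend.eventually_gt_atTop (r ^ 2)).and
    (Ioo_mem_nhdsGT (zero_lt_one' ℝ))).exists
  have h := hbound (EuclideanSpace.single ⟨0, hd⟩ x)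
  rw [PiLp.norm_single, Real.norm_of_nonneg hx0.le] at h
  have hy0 : 0 < x ^ α := Real.rpow_pos_of_pos hx0 _
  have hy1 : x ^ α < 1 := Real.rpow_lt_one hx0.le hx1 hα.1
  have hexp : Real.exp (-x ^ α) * (1 + x ^ α) ≤ 1 := by
    calc _ ≤ Real.exp (-x ^ α) * Real.exp (x ^ α) := by
          gcongr; linarith [Real.add_one_le_exp (x ^ α)]
      _ = 1 := by rw [← Real.exp_add]; simp
  have hsplit : x ^ α = x ^ (α - 2) * x ^ 2 := by
    rw [← Real.rpow_natCast, ← Real.rpow_add hx0]; norm_num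
  have hlt : r ^ 2 * x ^ 2 < x ^ α := by
    rw [hsplit]; gcongr
  nlinarith

/-- The probability that the process stays in a ball at the times `0, 1, …, n` decays
geometrically. -/
lemma measure_forall_norm_lt_le (hX : IsSymmetricStableProcess α X P) (hα : 0 < α) (R : ℝ)
    (n : ℕ) : P {ω | ∀ k ≤ n, ‖X (k : ℕ) ω‖ < R}
      ≤ P {ω | ‖X (0 + 1) ω - X 0 ω‖ < 2 * R} ^ n := by
  have hind := hX.indep_increments.nat (t := fun k : ℕ => (k : ℝ≥0)) Nat.mono_cast
  have hs : MeasurableSet {x : EuclideanSpace ℝ (Fin d) | ‖x‖ < 2 * R} :=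
    measurableSet_lt measurable_norm measurable_const
  have hinter := hind.meas_biInter (S := Finset.range n)
    (s := fun k : ℕ => {ω | ‖X ((k + 1 : ℕ) : ℝ≥0) ω - X (k : ℝ≥0) ω‖ < 2 * R})
    (fun k _ => ⟨_, hs, rfl⟩)
  calc P {ω | ∀ k ≤ n, ‖X (k : ℕ) ω‖ < R}
      ≤ P (⋂ k ∈ Finset.range n, {ω | ‖X ((k + 1 : ℕ) : ℝ≥0) ω - X (k : ℝ≥0) ω‖ < 2 * R}) := by
        refine measure_mono fun ω hω => ?_
        simp only [Set.mem_iInter, Finset.mem_range]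
        intro k hk
        have := norm_sub_le (X ((k + 1 : ℕ) : ℝ≥0) ω) (X (k : ℝ≥0) ω)
        have h1 : ‖X ((k + 1 : ℕ) : ℝ≥0) ω‖ < R := hω (k + 1) hk
        have h2 : ‖X (k : ℝ≥0) ω‖ < R := hω k hk.le
        show ‖X ((k + 1 : ℕ) : ℝ≥0) ω - X (k : ℝ≥0) ω‖ < 2 * R
        linarith
    _ = ∏ k ∈ Finset.range n, P {ω | ‖X (0 + 1) ω - X 0 ω‖ < 2 * R} := by
        rw [hinter]
        refine Finset.prod_congr rfl fun k _ => ?_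
        -- Scaling factor `1`: this is plain stationarity.
        have := (hX.identDistrib_increment_smul hα 1 1 k 0).measure_mem_eq hs
        simpa using this
    _ = _ := by simp

end IsSymmetricStableProcess

/-! ### Polynomial growth of the inverse tail, and summability. -/

section tail

lemma tailFun_antitone (ρ : ℝ → ℝ) : Antitone (tailFun ρ) := fun _ _ hst =>
  lintegral_mono_set fun _ hu => ⟨hu.1, hst.trans_lt hu.2⟩

lemma tailFun_le_lintegral (ρ : ℝ → ℝ) (s : ℝ≥0∞) :
    tailFun ρ s ≤ ∫⁻ t in Set.Ioi (0 : ℝ), ENNReal.ofReal (ρ t) :=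
  lintegral_mono_set fun _ hu => hu.1

lemma rhoDensity_of_one_lt {κ₁ κ₂ δ a t : ℝ} (ht : 1 < t) :
    rhoDensity κ₁ κ₂ δ a t = κ₂ / t ^ a := by
  rw [rhoDensity, Set.indicator_of_notMem (fun h => absurd h.2 (not_le.2 ht)),
    Set.indicator_of_mem (Set.mem_Ioi.2 ht), zero_add]

lemma rhoDensity_of_mem_Ioc {κ₁ κ₂ δ a t : ℝ} (ht : t ∈ Set.Ioc (0 : ℝ) 1) :
    rhoDensity κ₁ κ₂ δ a t = κ₁ * t ^ (δ - 1) * Real.exp (-t) := by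
  rw [rhoDensity, Set.indicator_of_mem (Set.Ioc_subset_Icc_self ht),
    Set.indicator_of_notMem (Set.notMem_Ioi.2 ht.2), add_zero]

/-- The mass of `(n + 1, n + 2]` alone suffices: there the power law applies and `ρ ≥ κ₂ / (n + 2) ^
a`. -/
lemma inv_tailFun_rhoDensity_le {κ₁ κ₂ δ a : ℝ} (hκ₂ : 0 < κ₂) (ha : 0 ≤ a) (n : ℕ) :
    (tailFun (rhoDensity κ₁ κ₂ δ a) (n + 1 : ℕ))⁻¹
      ≤ ENNReal.ofReal (((n + 2 : ℕ) : ℝ) ^ a / κ₂) := by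
  have hpos : (0 : ℝ) < ((n + 2 : ℕ) : ℝ) ^ a := by positivity
  have key : ENNReal.ofReal (κ₂ / ((n + 2 : ℕ) : ℝ) ^ a)
      ≤ tailFun (rhoDensity κ₁ κ₂ δ a) (n + 1 : ℕ) := by
    calc ENNReal.ofReal (κ₂ / ((n + 2 : ℕ) : ℝ) ^ a)
        = ∫⁻ _ in Set.Ioc ((n + 1 : ℕ) : ℝ) ((n + 2 : ℕ) : ℝ),
            ENNReal.ofReal (κ₂ / ((n + 2 : ℕ) : ℝ) ^ a) := by
          rw [setLIntegral_const, Real.volume_Ioc]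
          have : ((n + 2 : ℕ) : ℝ) - ((n + 1 : ℕ) : ℝ) = 1 := by push_cast; ring
          rw [this]; simp
      _ ≤ ∫⁻ t in Set.Ioc ((n + 1 : ℕ) : ℝ) ((n + 2 : ℕ) : ℝ),
            ENNReal.ofReal (rhoDensity κ₁ κ₂ δ a t) := by
          refine setLIntegral_mono' measurableSet_Ioc fun t ht => ?_
          have h1 : (1 : ℝ) < t :=
            lt_of_le_of_lt (by push_cast; linarith [n.cast_nonneg (α := ℝ)]) ht.1
          rw [rhoDensity_of_one_lt h1]
          have h0 : (0 : ℝ) < t := by linarith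
          have ht2 := ht.2
          gcongr
      _ ≤ _ := by
          refine lintegral_mono_set fun t ht => ?_
          have h0 : (0 : ℝ) < t := lt_of_le_of_lt (by positivity) ht.1
          refine ⟨h0, ?_⟩
          rw [← ENNReal.ofReal_natCast]
          exact (ENNReal.ofReal_lt_ofReal_iff h0).2 ht.1
  refine (ENNReal.inv_le_inv.2 key).trans ?_
  rw [← ENNReal.ofReal_inv_of_pos (by positivity), inv_div]

lemma summable_natCast_add_rpow_mul_geometric (a : ℝ) (l : ℕ) {q : ℝ} (hq0 : 0 ≤ q)
    (hq1 : q < 1) : Summable (fun n : ℕ => ((n + l : ℕ) : ℝ) ^ a * q ^ n) := by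
  -- Moving from `q` to `p > q` ensures `p > 0`, so the index shift by `l` costs only the factor `p
  -- ^ (-l)`, even if `q = 0`.
  obtain ⟨p, hqp, hp1⟩ := exists_between hq1
  have hp0 : 0 < p := hq0.trans_lt hqp
  obtain ⟨m, hm⟩ := exists_nat_ge a
  have hs := (summable_nat_add_iff l).2 (summable_pow_mul_geometric_of_norm_lt_one m
    (r := p) (by rwa [Real.norm_of_nonneg hp0.le]))
  refine Summable.of_norm_bounded_eventually_nat (hs.mul_right (p ^ l)⁻¹) ?_
  filter_upwards [eventually_ge_atTop 1] with n hn
  rw [Real.norm_of_nonneg (by positivity)]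
  have h1 : ((n + l : ℕ) : ℝ) ^ a ≤ ((n + l : ℕ) : ℝ) ^ m := by
    rw [← Real.rpow_natCast]
    exact Real.rpow_le_rpow_of_exponent_le (by exact_mod_cast hn.trans (Nat.le_add_right n l)) hm
  calc ((n + l : ℕ) : ℝ) ^ a * q ^ n ≤ ((n + l : ℕ) : ℝ) ^ m * p ^ n := by gcongr
    _ = _ := by rw [pow_add]; field_simp

end tail

/-- The value at the exit time of a monotone function which is at least `1` is controlled by its
values at the integers up to which the path stays inside the ball. -/
lemma le_add_tsum_of_exitTime {Ω : Type*} {d : ℕ} {R : ℝ}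
    (X : ℝ≥0 → Ω → EuclideanSpace ℝ (Fin d)) {g : ℝ≥0∞ → ℝ≥0∞} (hg : Monotone g)
    (hg1 : ∀ s, 1 ≤ g s) (ω : Ω) :
    g (exitTime R X 0 ω) ≤ g (0 + 1 : ℕ) + ∑' n : ℕ,
      {ω | ∀ k ≤ n, ‖X (k : ℕ) ω‖ < R}.indicator (fun _ => g (n + 1 + 1 : ℕ)) ω := by
  have hmem : ∀ n : ℕ, (n : ℝ≥0∞) < exitTime R X 0 ω →
      ω ∈ {ω | ∀ k ≤ n, ‖X (k : ℕ) ω‖ < R} := by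
    intro n hn k hk
    by_contra hcon
    have h1 : exitTime R X 0 ω ≤ ((k : ℝ≥0) : ℝ≥0∞) := iInf₂_le (k : ℝ≥0) (by simpa using hcon)
    have h2 : ((k : ℝ≥0) : ℝ≥0∞) ≤ n := by exact_mod_cast hk
    exact absurd hn (not_lt.2 (h1.trans h2))
  rcases eq_or_ne (exitTime R X 0 ω) ∞ with htop | htop
  · have : ∑' n : ℕ, {ω | ∀ k ≤ n, ‖X (k : ℕ) ω‖ < R}.indicator
        (fun _ => g (n + 1 + 1 : ℕ)) ω = ∞ := by
      -- A path that never exits lies in every survival event, and each term is at least `1`, so the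
      -- series diverges.
      refine top_unique ?_
      rw [← ENNReal.tsum_const_eq_top_of_ne_zero (α := ℕ) (one_ne_zero' ℝ≥0∞)]
      refine ENNReal.tsum_le_tsum fun n => ?_
      rw [Set.indicator_of_mem (hmem n (by simp [htop]))]
      exact hg1 _
    rw [this, add_top]
    exact le_top
  · obtain ⟨m, hm, hmin⟩ : ∃ m : ℕ, exitTime R X 0 ω ≤ (m + 1 : ℕ) ∧
        ∀ j < m, ((j + 1 : ℕ) : ℝ≥0∞) < exitTime R X 0 ω := by
      have hex : ∃ m : ℕ, exitTime R X 0 ω ≤ (m + 1 : ℕ) := by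
        obtain ⟨m, hm⟩ := ENNReal.exists_nat_gt htop
        exact ⟨m, hm.le.trans (by exact_mod_cast m.le_succ)⟩
      classical
      exact ⟨Nat.find hex, Nat.find_spec hex, fun j hj => not_le.1 (Nat.find_min hex hj)⟩
    rcases m with _ | n
    · exact (hg hm).trans le_self_add
    · refine (hg hm).trans (le_trans ?_ le_add_self)
      refine le_trans (le_of_eq ?_) (ENNReal.le_tsum n)
      -- Minimality gives survival past `n + 1`; only survival up to `n` is used.
      rw [Set.indicator_of_mem (hmem n (lt_trans (by exact_mod_cast n.lt_succ_self)
        (hmin n n.lt_succ_self)))]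

theorem proposition3p5 {Ω : Type*} [MeasurableSpace Ω] (P : Measure Ω) [IsProbabilityMeasure P]
    (d : ℕ) (hd : 2 ≤ d) (α : ℝ) (hα : α ∈ Set.Ioo (1 : ℝ) 2)
    (R : ℝ) (hR : 0 < R)
    (X : ℝ≥0 → Ω → EuclideanSpace ℝ (Fin d)) (hX : IsSymmetricStableProcess α X P)
    (δ : ℝ) (hδ : δ ∈ Set.Ioc (0 : ℝ) (1 - 1 / α)) (a : ℝ) (ha : 1 < a)
    (κ₁ κ₂ : ℝ) (hκ₁ : 0 < κ₁) (hκ₂ : 0 < κ₂)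
    (hρ : (∫⁻ t in Set.Ioi (0 : ℝ), ENNReal.ofReal (rhoDensity κ₁ κ₂ δ a t)) = 1) :
    AssumptionC α R X P (rhoDensity κ₁ κ₂ δ a) := by
  have hα0 : 0 < α := by linarith [hα.1]
  have hg : Monotone fun s => (tailFun (rhoDensity κ₁ κ₂ δ a) s)⁻¹ := fun s t hst =>
    ENNReal.inv_le_inv.2 (tailFun_antitone _ hst)
  refine ⟨?_, hg.measurable.comp_aemeasurable (hX.aemeasurable_exitTime hα0 hR), ?_⟩
  · have hc : 0 < κ₁ * Real.exp (-1) := by positivity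
    refine lt_of_le_of_lt (iSup₂_le fun t ht => ?_)
      (ENNReal.inv_lt_top.2 (ENNReal.ofReal_pos.2 hc))
    refine ENNReal.inv_le_inv.2 (ENNReal.ofReal_le_ofReal ?_)
    rw [rhoDensity_of_mem_Ioc ht]
    have h1 : t ^ (δ - 1) * t ^ (1 / α) = t ^ (δ - 1 + 1 / α) := (Real.rpow_add ht.1 _ _).symm
    have h2 : 1 ≤ t ^ (δ - 1 + 1 / α) :=
      Real.one_le_rpow_of_pos_of_le_one_of_nonpos ht.1 ht.2 (by linarith [hδ.2])
    calc κ₁ * Real.exp (-1) ≤ κ₁ * Real.exp (-t) * t ^ (δ - 1 + 1 / α) := by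
          refine le_trans ?_ (le_mul_of_one_le_right (by positivity) h2)
          gcongr
          exact ht.2
      _ = _ := by rw [← h1]; ring
  · set A : ℕ → Set Ω := fun n => {ω | ∀ k ≤ n, ‖X (k : ℕ) ω‖ < R} with hA
    have hAm : ∀ n, MeasurableSet (A n) := fun n => by
      have : A n = ⋂ (k : ℕ) (_ : k ≤ n), {ω | ‖X (k : ℕ) ω‖ < R} := by ext ω; simp [hA]
      rw [this]
      exact MeasurableSet.iInter fun k => MeasurableSet.iInter fun _ =>
        measurableSet_lt (hX.measurable _).norm measurable_const
    have hq1 := hX.measure_norm_increment_lt_lt_one (by omega) ⟨hα0, hα.2⟩ (2 * R)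
    set Q := P {ω | ‖X (0 + 1) ω - X 0 ω‖ < 2 * R} with hQ
    have hQt : Q ≠ ∞ := hq1.ne_top
    have hQr : Q.toReal < 1 := by
      simpa using (ENNReal.toReal_lt_toReal hQt ENNReal.one_ne_top).2 hq1
    have hterm : ∀ n : ℕ, (tailFun (rhoDensity κ₁ κ₂ δ a) (n + 1 + 1 : ℕ))⁻¹ * P (A n)
        ≤ ENNReal.ofReal (((n + 3 : ℕ) : ℝ) ^ a / κ₂ * Q.toReal ^ n) := fun n => by
      rw [ENNReal.ofReal_mul (by positivity), ENNReal.ofReal_pow ENNReal.toReal_nonneg,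
        ENNReal.ofReal_toReal hQt]
      exact mul_le_mul' (inv_tailFun_rhoDensity_le hκ₂ (by linarith) (n + 1))
        (hX.measure_forall_norm_lt_le hα0 R n)
    have hsum : Summable fun n : ℕ => ((n + 3 : ℕ) : ℝ) ^ a / κ₂ * Q.toReal ^ n := by
      have := (summable_natCast_add_rpow_mul_geometric a 3 ENNReal.toReal_nonneg hQr).mul_left κ₂⁻¹
      exact this.congr fun n => by ring
    calc ∫⁻ ω, (tailFun (rhoDensity κ₁ κ₂ δ a) (exitTime R X 0 ω))⁻¹ ∂P
        ≤ ∫⁻ ω, ((tailFun (rhoDensity κ₁ κ₂ δ a) (0 + 1 : ℕ))⁻¹ + ∑' n : ℕ, (A n).indicator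
            (fun _ => (tailFun (rhoDensity κ₁ κ₂ δ a) (n + 1 + 1 : ℕ))⁻¹) ω) ∂P :=
          lintegral_mono fun ω => le_add_tsum_of_exitTime X hg (fun s => by
            -- The total mass `1` of `ρ` bounds the tail, so its inverse is at least `1`.
            rw [ENNReal.one_le_inv, ← hρ]; exact tailFun_le_lintegral _ _) ω
      _ = (tailFun (rhoDensity κ₁ κ₂ δ a) (0 + 1 : ℕ))⁻¹
            + ∑' n : ℕ, (tailFun (rhoDensity κ₁ κ₂ δ a) (n + 1 + 1 : ℕ))⁻¹ * P (A n) := by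
          rw [lintegral_add_left measurable_const, lintegral_const, measure_univ, mul_one,
            lintegral_tsum fun n => (measurable_const.indicator (hAm n)).aemeasurable]
          congr 2
          funext n
          rw [lintegral_indicator_const (hAm n)]
      _ ≤ ENNReal.ofReal (((0 + 2 : ℕ) : ℝ) ^ a / κ₂)
            + ∑' n : ℕ, ENNReal.ofReal (((n + 3 : ℕ) : ℝ) ^ a / κ₂ * Q.toReal ^ n) :=
          add_le_add (inv_tailFun_rhoDensity_le hκ₂ (by linarith) 0)
            (ENNReal.tsum_le_tsum hterm)
      _ < ∞ := ENNReal.add_lt_top.2 ⟨ENNReal.ofReal_lt_top, hsum.tsum_ofReal_lt_top⟩
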